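/- Let $\mathcal H,\mathcal F,\mathcal Y$ be real Hilbert spaces, let $L:\mathcal D(L)\subset\mathcal H\to\mathcal F$ be a closed, densely defined linear operator, and let $H:\mathcal H\to\mathcal Y$ be a bounded linear operator. Write $R(\cdot)$ and $N(\cdot)$ for range and kernel, and assume that at least one of the following holds: (1) $R(L)$ and $H(N(L))$ are closed; (2) $\{(Lx,Hx):x\in\mathcal D(L)\}$ is closed in $\mathcal F\times\mathcal Y$. Let $y\in\mathcal Y$ be such that the a posteriori set $$\mathcal X_y=\{\varphi\in\mathcal D(L):\ \|L\varphi\|^2+\|y-H\varphi\|^2\le 1\}$$ is non-empty. For $\ell\in\mathcal H$ put $$\hat d(\ell)=\inf_{\varphi\in\mathcal X_y}\sup_{\psi\in\mathcal X_y}|(\ell,\varphi)-(\ell,\psi)|\in[0,\infty],$$ and call $\hat\varphi\in\mathcal H$ a minimax a posteriori estimate in the direction $\ell$ if $\sup_{\psi\in\mathcal X_y}|(\ell,\hat\varphi)-(\ell,\psi)|=\hat d(\ell)$. Let $\hat\sigma(\ell)\in[0,\infty]$ be the a priori minimax mean-squared error, $$\hat\sigma(\ell)=\Bigl(\inf_{u\in\mathcal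 Y,\,c\in\mathbb R}\ \sup_{\varphi,\,\eta}\ M\bigl((\ell,\varphi)-(u,H\varphi+\eta)-c\bigr)^2\Bigr)^{1/2},$$ where $M$ denotes expectation and the supremum is over all $\varphi\in\mathcal D(L)$ with $\|L\varphi\|\le1$ and all square-integrable random vectors $\eta$ in $\mathcal Y$ with zero mean and $M(\eta,\eta)\le1$. Consider the system $$L^*\hat q=H^*(y-H\hat\varphi),\qquad L\hat\varphi=\hat q,\qquad \hat\varphi\in\mathcal D(L),\ \hat q\in\mathcal D(L^*).\tag{$*$}$$ **Theorem.** The system $(*)$ has a solution, and a vector $\hat\varphi\in\mathcal H$ satisfies $(*)$ (with some $\hat q$) if and only if it is a minimax a posteriori estimate in every direction $\ell\in R(L^*)+R(H^*)$. Let $(\hat\varphi,\hat q)$ be any solution of $(*)$. Then $\hat\varphi\in\mathcal X_y$ and $(y,y-H\hat\varphi)\le1$, and for every $\ell\in\mathcal H$, $\hat\varphi$ is a minimax a posteriori estimate in the direction $\ell$ with finite error $\hat d(\ell)$ if and only if $\ell\in R(L^*)+R(H^*)$. For such $\ell$, a vector $\varphi'\in\mathcal H$ is a minimax a posteriori estimate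 in the direction $\ell$ if and only if $(\ell,\varphi')=(\ell,\hat\varphi)$; moreover $\hat\sigma(\ell)<\infty$ and $$\hat d(\ell)=\bigl(1-(y,y-H\hat\varphi)\bigr)^{1/2}\,\hat\sigma(\ell).$$ -/

import Mathlib

open MeasureTheory
open scoped ENNReal

namespace MinimaxEstimation

variable {X F Y : Type*}
  [NormedAddCommGroup X] [InnerProductSpace ℝ X]
  [NormedAddCommGroup F] [InnerProductSpace ℝ F]
  [NormedAddCommGroup Y] [InnerProductSpace ℝ Y]

/-- The a posteriori set `{φ ∈ D(L) : (L φ, y - H φ) ∈ G}`. -/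
def aPosterioriSet (L : X →ₗ.[ℝ] F) (H : X →L[ℝ] Y) (G : Set (F × Y)) (y : Y) : Set X :=
  {φ | ∃ hφ : φ ∈ L.domain, (L ⟨φ, hφ⟩, y - H φ) ∈ G}

/-- The worst case error over the a posteriori set when `(ℓ, φ)` is used as the estimate:
`sup_{ψ ∈ S} |(ℓ, φ) - (ℓ, ψ)|`, possibly infinite. -/
noncomputable def worstError (S : Set X) (l φ : X) : ℝ≥0∞ :=
  ⨆ ψ ∈ S, ENNReal.ofReal |inner ℝ l φ - inner ℝ l ψ|

/-- The minimax a posteriori error in the direction `l`: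
`inf_{φ ∈ S} sup_{ψ ∈ S} |(l, φ) - (l, ψ)|`. -/
noncomputable def aPosterioriError (S : Set X) (l : X) : ℝ≥0∞ :=
  ⨅ φ ∈ S, worstError S l φ

/-- The vector `φ` is a minimax a posteriori estimate in the direction `l`. -/
def IsMinimaxEstimate (S : Set X) (l φ : X) : Prop :=
  aPosterioriError S l = worstError S l φ

/-- The ellipsoid (unit ball) `{(f, η) : ‖f‖² + ‖η‖² ≤ 1}`. -/
def jointBall (F Y : Type*) [NormedAddCommGroup F] [NormedAddCommGroup Y] : Set (F × Y) :=
  {p | ‖p.1‖ ^ 2 + ‖p.2‖ ^ 2 ≤ 1}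

/-- The laws of the admissible random noises: square integrable `Y`-valued random vectors `η`
with zero mean and `M (η, η) ≤ 1`. -/
def noiseLaws (Y : Type*) [NormedAddCommGroup Y] [InnerProductSpace ℝ Y] [MeasurableSpace Y] :
    Set (Measure Y) :=
  {μ | IsProbabilityMeasure μ ∧ MemLp (fun η : Y => η) 2 μ ∧ ∫ η, η ∂μ = 0 ∧
    ∫ η, inner ℝ η η ∂μ ≤ 1}

/-- The worst case mean-squared error of the affine estimate `(u, ·) + c` of `(l, φ)` from
`H φ + η`, over all `φ ∈ D(L)` with `L φ ∈ G₁` and all noises `η` with law in `N`. -/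
noncomputable def aPrioriRisk [MeasurableSpace Y] (L : X →ₗ.[ℝ] F) (H : X →L[ℝ] Y)
    (G₁ : Set F) (N : Set (Measure Y)) (l : X) (u : Y) (c : ℝ) : ℝ≥0∞ :=
  ⨆ (φ : L.domain) (_ : L φ ∈ G₁) (μ : Measure Y) (_ : μ ∈ N),
    ∫⁻ η, ENNReal.ofReal
      ((inner ℝ l (φ : X) - (inner ℝ u (H (φ : X) + η) + c)) ^ 2) ∂μ

/-- The (a priori) minimax mean-squared error in the direction `l`. -/
noncomputable def aPrioriError [MeasurableSpace Y] (L : X →ₗ.[ℝ] F) (H : X →L[ℝ] Y)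
    (G₁ : Set F) (N : Set (Measure Y)) (l : X) : ℝ≥0∞ :=
  (⨅ (u : Y) (c : ℝ), aPrioriRisk L H G₁ N l u c) ^ (1 / 2 : ℝ)

/-- The set `R(L*) + R(H*)`. -/
noncomputable def adjointRangeSum [CompleteSpace X] [CompleteSpace Y]
    (L : X →ₗ.[ℝ] F) (H : X →L[ℝ] Y) : Set X :=
  {l | ∃ (z : L.adjoint.domain) (u : Y), l = L.adjoint z + ContinuousLinearMap.adjoint H u}

/-- The pair `(φ, q)` solves `L* q = H* (y - H φ)`, `L φ = q`
(with `φ ∈ D(L)` and `q ∈ D(L*)`). -/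
def SolvesSystem [CompleteSpace X] [CompleteSpace Y]
    (L : X →ₗ.[ℝ] F) (H : X →L[ℝ] Y) (y : Y) (φ : X) (q : F) : Prop :=
  ∃ (hφ : φ ∈ L.domain) (hq : q ∈ L.adjoint.domain),
    L.adjoint ⟨q, hq⟩ = ContinuousLinearMap.adjoint H (y - H φ) ∧ L ⟨φ, hφ⟩ = q

end MinimaxEstimation

/-! Write `T x = (L x, H x)`. It is a closed operator, and either closedness condition makes its
range closed. The system is the normal equation for approximating `(0, y)` by `T φ`, so orthogonal
projection onto the range solves it. Completing the square at a solution `φ` turns the a posteriori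
set into `φ + {x : ‖T x‖² ≤ β²}` with `β² = 1 - (y, y - H φ)`. This set is symmetric about `φ`, so
`φ` is minimax in every direction; when the error is finite, only vectors with the same value of
`(ℓ, ·)` are. The set contains lines along `N(T)`, so finite error forces `ℓ ⟂ N(T)`. By closed
range this means `(ℓ, x) = (T x₀, T x)` for some `x₀`, that is, `ℓ ∈ R(L*) + R(H*)`. For such `ℓ`,
Cauchy-Schwarz gives a posteriori error `β ‖T x₀‖`, attained along `x₀`. The a priori error is `‖T
x₀‖`: the estimate `u = H x₀`, `c = 0` achieves it, and multiples of `x₀` with two-point noise show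
that no other does better. The error formula is the comparison of the two. -/

/-! ### Closed operators with closed range. -/

namespace LinearPMap

variable {X E : Type*} [NormedAddCommGroup X] [NormedAddCommGroup E]

/-- A closed operator with closed range admits preimages of controlled norm. -/
theorem IsClosed.exists_preimage_norm_le [NormedSpace ℝ X] [NormedSpace ℝ E]
    [CompleteSpace X] [CompleteSpace E] {T : X →ₗ.[ℝ] E} (hT : T.IsClosed)
    (hR : _root_.IsClosed (LinearMap.range T.toFun : Set E)) :
    ∃ C : ℝ, 0 < C ∧ ∀ e ∈ LinearMap.range T.toFun,
      ∃ x : T.domain, T x = e ∧ ‖(x : X)‖ ≤ C * ‖e‖ := by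
  have : CompleteSpace T.graph := IsClosed.completeSpace_coe (hs := hT)
  have : CompleteSpace (LinearMap.range T.toFun) := hR.completeSpace_coe
  -- Graph and range are Banach spaces, so the open mapping theorem applies to the projection of the
  -- graph onto the range.
  let f : T.graph →L[ℝ] LinearMap.range T.toFun :=
    ((ContinuousLinearMap.snd ℝ X E).comp T.graph.subtypeL).codRestrict _ (by
      rintro ⟨⟨a, b⟩, hab⟩
      obtain ⟨x, -, hx⟩ := (LinearPMap.mem_graph_iff T).1 hab
      exact ⟨x, hx⟩)
  have hf : Function.Surjective f := by
    rintro ⟨_, x, rfl⟩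
    exact ⟨⟨(x, T x), T.mem_graph x⟩, rfl⟩
  obtain ⟨C, hC, h⟩ := f.exists_preimage_norm_le hf
  refine ⟨C, hC, fun e he => ?_⟩
  obtain ⟨⟨⟨a, b⟩, hab⟩, hg, hn⟩ := h ⟨e, he⟩
  obtain ⟨x, hx, hx'⟩ := (LinearPMap.mem_graph_iff T).1 hab
  simp only at hx hx'
  refine ⟨x, hx'.trans (congrArg Subtype.val hg), ?_⟩
  rw [hx]
  exact (norm_fst_le (a, b)).trans hn

variable [InnerProductSpace ℝ X] [InnerProductSpace ℝ E] [CompleteSpace E]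

/-- For a closed operator `T` with closed range, every vector orthogonal to `ker T` is of the form
`T* T x₀`, in the weak sense. -/
theorem IsClosed.exists_inner_eq_of_orthogonal_ker [CompleteSpace X] {T : X →ₗ.[ℝ] E}
    (hT : T.IsClosed) (hR : _root_.IsClosed (LinearMap.range T.toFun : Set E)) {l : X}
    (hl : ∀ x : T.domain, T x = 0 → inner ℝ l (x : X) = 0) :
    ∃ x₀ : T.domain, ∀ x : T.domain, inner ℝ l (x : X) = inner ℝ (T x₀) (T x) := by
  have : CompleteSpace (LinearMap.range T.toFun) := hR.completeSpace_coe
  obtain ⟨C, hC, hpre⟩ := hT.exists_preimage_norm_le hR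
  let g₀ : Module.Dual ℝ T.domain := (innerSL ℝ l).toLinearMap.comp T.domain.subtype
  -- Vanishing on the kernel makes the functional factor algebraically through `T`; the
  -- norm-controlled preimages then make the factor continuous, and Riesz applies on the range.
  have hg₀ : g₀ ∈ LinearMap.range T.toFun.dualMap := by
    rw [LinearMap.range_dualMap_eq_dualAnnihilator_ker, Submodule.mem_dualAnnihilator]
    intro x hx
    exact hl x hx
  obtain ⟨g, hg⟩ := hg₀
  have hg' (x : T.domain) : g (T x) = inner ℝ l (x : X) := congrArg (fun k => k x) hg
  let G : StrongDual ℝ (LinearMap.range T.toFun) :=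
    (g.comp (LinearMap.range T.toFun).subtype).mkContinuous (‖l‖ * C) (by
      rintro ⟨e, he⟩
      obtain ⟨x, rfl, hx⟩ := hpre e he
      change ‖g (T x)‖ ≤ _
      rw [hg', mul_assoc]
      exact (norm_inner_le_norm l (x : X)).trans
        (mul_le_mul_of_nonneg_left hx (norm_nonneg _)))
  obtain ⟨x₀, hx₀⟩ := ((InnerProductSpace.toDual ℝ _).symm G).2
  refine ⟨x₀, fun x => ?_⟩
  have := InnerProductSpace.toDual_symm_apply (𝕜 := ℝ)
    (x := (⟨T x, ⟨x, rfl⟩⟩ : LinearMap.range T.toFun)) (y := G)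
  rw [← hg']
  refine Eq.trans this.symm ?_
  rw [Submodule.coe_inner, ← hx₀]
  rfl

/-- The normal equation `T* T x₀ = T* e` is solvable, in the weak sense, for closed range. -/
theorem exists_normal_equation {T : X →ₗ.[ℝ] E}
    (hR : _root_.IsClosed (LinearMap.range T.toFun : Set E)) (e : E) :
    ∃ x₀ : T.domain, ∀ x : T.domain, inner ℝ (e - T x₀) (T x) = 0 := by
  have : CompleteSpace (LinearMap.range T.toFun) := hR.completeSpace_coe
  obtain ⟨x₀, hx₀⟩ := (LinearMap.range T.toFun).starProjection_apply_mem e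
  refine ⟨x₀, fun x => ?_⟩
  have := Submodule.starProjection_inner_eq_zero (K := LinearMap.range T.toFun) e (T x) ⟨x, rfl⟩
  rwa [← hx₀] at this

end LinearPMap

/-! ### The stacked operator and weak forms of the conditions. -/

namespace MinimaxEstimation

variable {X F Y : Type*}
  [NormedAddCommGroup X] [InnerProductSpace ℝ X]
  [NormedAddCommGroup F] [InnerProductSpace ℝ F]
  [NormedAddCommGroup Y] [InnerProductSpace ℝ Y]

/-- The operator `x ↦ (L x, H x)` with domain `D(L)`. -/
noncomputable def stackedMap (L : X →ₗ.[ℝ] F) (H : X →L[ℝ] Y) : X →ₗ.[ℝ] WithLp 2 (F × Y) where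
  domain := L.domain
  toFun := (WithLp.linearEquiv 2 ℝ (F × Y)).symm.toLinearMap.comp
    (L.toFun.prod (H.toLinearMap.comp L.domain.subtype))

theorem stackedMap_apply (L : X →ₗ.[ℝ] F) (H : X →L[ℝ] Y) (x : L.domain) :
    stackedMap L H x = WithLp.toLp 2 (L x, H (x : X)) := rfl

theorem isClosed_stackedMap {L : X →ₗ.[ℝ] F} (hL : L.IsClosed) (H : X →L[ℝ] Y) :
    (stackedMap L H).IsClosed := by
  have h : ((stackedMap L H).graph : Set (X × WithLp 2 (F × Y))) =
      {p | (p.1, p.2.fst) ∈ L.graph} ∩ {p | p.2.snd = H p.1} := by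
    ext ⟨a, b⟩
    simp only [SetLike.mem_coe, LinearPMap.mem_graph_iff, Set.mem_inter_iff, Set.mem_ofPred_eq]
    constructor
    · rintro ⟨x, rfl, rfl⟩
      exact ⟨⟨x, rfl, rfl⟩, rfl⟩
    · rintro ⟨⟨x, rfl, hx⟩, hb⟩
      refine ⟨x, rfl, ?_⟩
      rw [stackedMap_apply, hx, ← hb]
      rfl
  rw [LinearPMap.IsClosed, h]
  have hfst : Continuous fun p : X × WithLp 2 (F × Y) => p.2.fst :=
    (WithLp.prod_continuous_ofLp 2 F Y).fst.comp continuous_snd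
  have hsnd : Continuous fun p : X × WithLp 2 (F × Y) => p.2.snd :=
    (WithLp.prod_continuous_ofLp 2 F Y).snd.comp continuous_snd
  exact (IsClosed.preimage (continuous_fst.prodMk hfst) hL).inter
    (isClosed_eq hsnd (H.continuous.comp continuous_fst))

section AdjointRange

variable [CompleteSpace X] [CompleteSpace Y]

/-- Membership of `z` in `D(L*)` need not be demanded: the identity exhibits `l - H* u` as a
representer of `(z, L ·)`. -/
theorem mem_adjointRangeSum_iff {L : X →ₗ.[ℝ] F} (hd : Dense (L.domain : Set X)) (H : X →L[ℝ] Y)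
    (l : X) : l ∈ adjointRangeSum L H ↔ ∃ (z : F) (u : Y), ∀ x : L.domain,
      inner ℝ l (x : X) = inner ℝ z (L x) + inner ℝ u (H (x : X)) := by
  constructor
  · rintro ⟨z, u, rfl⟩
    refine ⟨z, u, fun x => ?_⟩
    rw [inner_add_left, ContinuousLinearMap.adjoint_inner_left,
      LinearPMap.adjoint_isFormalAdjoint hd z x]
  · rintro ⟨z, u, h⟩
    have h' (x : L.domain) :
        inner ℝ (l - ContinuousLinearMap.adjoint H u) (x : X) = inner ℝ z (L x) := by
      rw [inner_sub_left, h, ContinuousLinearMap.adjoint_inner_left, add_sub_cancel_right]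
    refine ⟨⟨z, LinearPMap.mem_adjoint_domain_of_exists z ⟨_, h'⟩⟩, u, ?_⟩
    rw [LinearPMap.adjoint_apply_eq hd _ h', sub_add_cancel]

theorem exists_solvesSystem_iff {L : X →ₗ.[ℝ] F} (hd : Dense (L.domain : Set X)) (H : X →L[ℝ] Y)
    (y : Y) (φ : X) : (∃ q, SolvesSystem L H y φ q) ↔ ∃ hφ : φ ∈ L.domain, ∀ x : L.domain,
      inner ℝ (L ⟨φ, hφ⟩) (L x) = inner ℝ (y - H φ) (H (x : X)) := by
  constructor
  · rintro ⟨q, hφ, hq, h, rfl⟩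
    refine ⟨hφ, fun x => ?_⟩
    have := LinearPMap.adjoint_isFormalAdjoint hd ⟨_, hq⟩ x
    rw [h, ContinuousLinearMap.adjoint_inner_left] at this
    exact this.symm
  · rintro ⟨hφ, h⟩
    have h' (x : L.domain) : inner ℝ (ContinuousLinearMap.adjoint H (y - H φ)) (x : X) =
        inner ℝ (L ⟨φ, hφ⟩) (L x) := by
      rw [h, ContinuousLinearMap.adjoint_inner_left]
    exact ⟨L ⟨φ, hφ⟩, hφ, LinearPMap.mem_adjoint_domain_of_exists _ ⟨_, h'⟩,
      LinearPMap.adjoint_apply_eq hd _ h', rfl⟩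

end AdjointRange

/-- The normal equation of the stacked operator with data `(0, y)`. -/
theorem exists_weak_solution [CompleteSpace F] [CompleteSpace Y] {L : X →ₗ.[ℝ] F} (H : X →L[ℝ] Y)
    (hR : IsClosed (LinearMap.range (stackedMap L H).toFun : Set (WithLp 2 (F × Y)))) (y : Y) :
    ∃ x₀ : L.domain, ∀ x : L.domain,
      inner ℝ (L x₀) (L x) = inner ℝ (y - H (x₀ : X)) (H (x : X)) := by
  obtain ⟨x₀, h⟩ := LinearPMap.exists_normal_equation (T := stackedMap L H) hR
    (WithLp.toLp 2 (0, y))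
  refine ⟨x₀, fun x => ?_⟩
  have h' : inner ℝ (0 - L x₀) (L x) + inner ℝ (y - H (x₀ : X)) (H (x : X)) = 0 := h x
  rw [zero_sub, inner_neg_left] at h'
  linarith

variable [CompleteSpace X] [CompleteSpace F]

/-- Closedness of `R(L)` and `H(N(L))` implies closedness of the joint range. -/
theorem isClosed_jointRange {L : X →ₗ.[ℝ] F} (hL : L.IsClosed) (H : X →L[ℝ] Y)
    (hR : IsClosed {f : F | ∃ x : L.domain, L x = f})
    (hN : IsClosed {v : Y | ∃ x : L.domain, L x = 0 ∧ H (x : X) = v}) :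
    IsClosed {p : F × Y | ∃ x : L.domain, (L x, H (x : X)) = p} := by
  obtain ⟨C, hC, hpre⟩ := hL.exists_preimage_norm_le hR
  refine IsSeqClosed.isClosed fun p q hp hpq => ?_
  choose x hx using hp
  have hL1 : Filter.Tendsto (fun n => L (x n)) Filter.atTop (nhds q.1) := by
    have := (continuous_fst.tendsto q).comp hpq
    simpa only [Function.comp_def, ← hx] using this
  have hH1 : Filter.Tendsto (fun n => H (x n : X)) Filter.atTop (nhds q.2) := by
    have := (continuous_snd.tendsto q).comp hpq
    simpa only [Function.comp_def, ← hx] using this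
  obtain ⟨w, hw⟩ : ∃ w : L.domain, L w = q.1 :=
    hR.mem_of_tendsto hL1 (Filter.Eventually.of_forall fun n => ⟨x n, rfl⟩)
  -- The corrections `z n` tend to zero and move `x n - w` into `N(L)`, so that closedness of
  -- `H(N(L))` captures the limit of the second components.
  have hd (n : ℕ) : ∃ z : L.domain, L z = L (x n) - L w ∧ ‖(z : X)‖ ≤ C * ‖L (x n) - L w‖ :=
    hpre _ ⟨x n - w, L.map_sub _ _⟩
  choose z hz hzn using hd
  have hz0 : Filter.Tendsto (fun n => (z n : X)) Filter.atTop (nhds 0) := by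
    refine squeeze_zero_norm hzn ?_
    have := (hL1.sub_const (L w)).norm.const_mul C
    simpa [hw] using this
  have hlim : Filter.Tendsto (fun n => H ((x n - z n - w : L.domain) : X)) Filter.atTop
      (nhds (q.2 - H w)) := by
    have := (hH1.sub ((H.continuous.tendsto 0).comp hz0)).sub_const (H (w : X))
    simpa [Function.comp_def] using this
  obtain ⟨k, hk0, hk⟩ := hN.mem_of_tendsto hlim (Filter.Eventually.of_forall fun n =>
    ⟨x n - z n - w, by rw [L.map_sub, L.map_sub, hz]; abel, rfl⟩)
  refine ⟨w + k, Prod.ext ?_ ?_⟩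
  · change L (w + k) = q.1
    rw [L.map_add, hk0, add_zero, hw]
  · simp [hk]

/-- The standing closedness condition gives closedness of the range of the stacked operator. -/
theorem isClosed_range_stackedMap {L : X →ₗ.[ℝ] F} (hL : L.IsClosed) (H : X →L[ℝ] Y)
    (hcond :
      (IsClosed {f : F | ∃ x : L.domain, L x = f} ∧
        IsClosed {v : Y | ∃ x : L.domain, L x = 0 ∧ H (x : X) = v}) ∨
      IsClosed {p : F × Y | ∃ x : L.domain, (L x, H (x : X)) = p}) :
    IsClosed (LinearMap.range (stackedMap L H).toFun : Set (WithLp 2 (F × Y))) := by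
  have h : IsClosed {p : F × Y | ∃ x : L.domain, (L x, H (x : X)) = p} :=
    hcond.elim (fun h => isClosed_jointRange hL H h.1 h.2) id
  convert h.preimage (WithLp.prod_continuous_ofLp 2 F Y) using 1
  ext p
  constructor
  · rintro ⟨x, rfl⟩
    exact ⟨x, rfl⟩
  · rintro ⟨x, hx⟩
    exact ⟨x, congrArg (WithLp.toLp 2) hx⟩

variable [CompleteSpace Y]

theorem exists_representer {L : X →ₗ.[ℝ] F} (hL : L.IsClosed) (H : X →L[ℝ] Y)
    (hR : IsClosed (LinearMap.range (stackedMap L H).toFun : Set (WithLp 2 (F × Y)))) {l : X}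
    (hl : ∀ x : L.domain, L x = 0 → H (x : X) = 0 → inner ℝ l (x : X) = 0) :
    ∃ x₀ : L.domain, ∀ x : L.domain,
      inner ℝ l (x : X) = inner ℝ (L x₀) (L x) + inner ℝ (H (x₀ : X)) (H (x : X)) := by
  obtain ⟨x₀, h⟩ := (isClosed_stackedMap hL H).exists_inner_eq_of_orthogonal_ker hR (l := l)
    (fun x hx => by
      have hx' : (L x, H (x : X)) = 0 := congrArg WithLp.ofLp hx
      exact hl x (congrArg Prod.fst hx') (congrArg Prod.snd hx'))
  exact ⟨x₀, h⟩

end MinimaxEstimation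

/-! ### Geometry of the a posteriori set. -/

namespace MinimaxEstimation

section SymmetricSet

variable {X : Type*} [NormedAddCommGroup X] [InnerProductSpace ℝ X]

/-- For a set symmetric about `φ`, moving the estimate away from `φ` adds to the error. -/
theorem worstError_eq_add {S : Set X} {φ : X} (hφ : φ ∈ S)
    (hsymm : ∀ ψ ∈ S, φ + (φ - ψ) ∈ S) (l φ' : X) :
    worstError S l φ' =
      ENNReal.ofReal |inner ℝ l φ' - inner ℝ l φ| + worstError S l φ := by
  unfold worstError
  rw [ENNReal.add_biSup ⟨φ, hφ⟩]
  refine le_antisymm (iSup₂_mono fun ψ _ => ?_) (iSup₂_le fun ψ hψ => ?_)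
  · rw [← ENNReal.ofReal_add (abs_nonneg _) (abs_nonneg _)]
    exact ENNReal.ofReal_le_ofReal (abs_sub_le _ _ _)
  · rw [← ENNReal.ofReal_add (abs_nonneg _) (abs_nonneg _)]
    -- Either `ψ` or its reflection lies on the far side of `φ` from `φ'`, as measured by `(l, ·)`;
    -- there the distances add.
    have key : |inner ℝ l φ' - inner ℝ l φ| + |inner ℝ l φ - inner ℝ l ψ| ≤
        |inner ℝ l φ' - inner ℝ l ψ| ∨
        |inner ℝ l φ' - inner ℝ l φ| + |inner ℝ l φ - inner ℝ l ψ| ≤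
        |inner ℝ l φ' - inner ℝ l (φ + (φ - ψ))| := by
      rw [inner_add_right, inner_sub_right]
      generalize inner ℝ l φ' = a, inner ℝ l φ = b, inner ℝ l ψ = c
      grind
    rcases key with h | h
    · exact (ENNReal.ofReal_le_ofReal h).trans (le_iSup₂_of_le ψ hψ le_rfl)
    · exact (ENNReal.ofReal_le_ofReal h).trans (le_iSup₂_of_le _ (hsymm ψ hψ) le_rfl)

theorem aPosterioriError_eq {S : Set X} {φ : X} (hφ : φ ∈ S)
    (hsymm : ∀ ψ ∈ S, φ + (φ - ψ) ∈ S) (l : X) :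
    aPosterioriError S l = worstError S l φ := by
  refine le_antisymm (iInf₂_le φ hφ) (le_iInf₂ fun φ' _ => ?_)
  rw [worstError_eq_add hφ hsymm l φ']
  exact le_add_self

theorem isMinimaxEstimate_iff {S : Set X} {φ : X} (hφ : φ ∈ S)
    (hsymm : ∀ ψ ∈ S, φ + (φ - ψ) ∈ S) {l : X} (hl : worstError S l φ ≠ ⊤) (φ' : X) :
    IsMinimaxEstimate S l φ' ↔ inner ℝ l φ' = inner ℝ l φ := by
  rw [IsMinimaxEstimate, aPosterioriError_eq hφ hsymm, worstError_eq_add hφ hsymm l φ']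
  constructor
  · intro h
    have h0 : ENNReal.ofReal |inner ℝ l φ' - inner ℝ l φ| = 0 :=
      (ENNReal.add_left_inj hl).1 (h.symm.trans (zero_add _).symm)
    rw [ENNReal.ofReal_eq_zero] at h0
    exact sub_eq_zero.1 (abs_nonpos_iff.1 h0)
  · intro h
    simp [h]

/-- Finite error over a set invariant under translation along `x` forces `l ⟂ x`. -/
theorem inner_eq_zero_of_worstError_ne_top {S : Set X} {l φ x : X}
    (hl : worstError S l φ ≠ ⊤) (hx : ∀ t : ℝ, φ + t • x ∈ S) : inner ℝ l x = 0 := by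
  by_contra h
  obtain ⟨C, hC⟩ : ∃ C : ℝ, ∀ t : ℝ, |t * inner ℝ l x| ≤ C := by
    refine ⟨(worstError S l φ).toReal, fun t => ?_⟩
    rw [← ENNReal.ofReal_le_iff_le_toReal hl]
    refine le_of_eq_of_le ?_ (le_iSup₂_of_le _ (hx t) le_rfl)
    rw [inner_add_right, inner_smul_right, sub_add_cancel_left, abs_neg]
  have := hC ((|C| + 1) / inner ℝ l x)
  rw [div_mul_cancel₀ _ h] at this
  have h1 := le_abs_self C
  have h2 := le_abs_self (|C| + 1)
  linarith

end SymmetricSet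

variable {X F Y : Type*}
  [NormedAddCommGroup X] [InnerProductSpace ℝ X]
  [NormedAddCommGroup F] [InnerProductSpace ℝ F]
  [NormedAddCommGroup Y] [InnerProductSpace ℝ Y]

/-- Completing the square at a solution of the normal equation. -/
theorem residual_eq {L : X →ₗ.[ℝ] F} {H : X →L[ℝ] Y} {y : Y} {φ : L.domain}
    (hφ : ∀ x : L.domain, inner ℝ (L φ) (L x) = inner ℝ (y - H (φ : X)) (H (x : X)))
    (x : L.domain) :
    ‖L (φ + x)‖ ^ 2 + ‖y - H ((φ + x : L.domain) : X)‖ ^ 2 =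
      inner ℝ y (y - H (φ : X)) + (‖L x‖ ^ 2 + ‖H (x : X)‖ ^ 2) := by
  have e : y - H ((φ + x : L.domain) : X) = (y - H (φ : X)) - H (x : X) := by
    rw [Submodule.coe_add, map_add, sub_add_eq_sub_sub]
  have e2 : inner ℝ y (y - H (φ : X)) =
      ‖y - H (φ : X)‖ ^ 2 + inner ℝ (y - H (φ : X)) (H (φ : X)) := by
    rw [← real_inner_self_eq_norm_sq, ← inner_add_right, sub_add_cancel, real_inner_comm]
  rw [e, L.map_add, norm_add_sq_real, norm_sub_sq_real, e2, ← hφ φ, hφ x,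
    real_inner_self_eq_norm_sq]
  ring

theorem mem_aPosterioriSet_iff {L : X →ₗ.[ℝ] F} {H : X →L[ℝ] Y} {y : Y} {φ : L.domain}
    (hφ : ∀ x : L.domain, inner ℝ (L φ) (L x) = inner ℝ (y - H (φ : X)) (H (x : X)))
    (ψ : X) :
    ψ ∈ aPosterioriSet L H (jointBall F Y) y ↔
      ∃ x : L.domain, ψ = φ + x ∧
        ‖L x‖ ^ 2 + ‖H (x : X)‖ ^ 2 ≤ 1 - inner ℝ y (y - H (φ : X)) := by
  constructor
  · rintro ⟨hψ, h⟩
    refine ⟨⟨ψ, hψ⟩ - φ, by simp, ?_⟩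
    have := residual_eq hφ (⟨ψ, hψ⟩ - φ)
    rw [add_sub_cancel] at this
    have h' : ‖L ⟨ψ, hψ⟩‖ ^ 2 + ‖y - H ψ‖ ^ 2 ≤ 1 := h
    rw [this] at h'
    linarith
  · rintro ⟨x, rfl, h⟩
    refine ⟨(φ + x).2, ?_⟩
    have := residual_eq hφ x
    change ‖L (φ + x)‖ ^ 2 + ‖y - H ((φ + x : L.domain) : X)‖ ^ 2 ≤ 1
    linarith

/-- The left side is the minimum of the energy defining the set, attained at `φ`. -/
theorem inner_residual_le_one {L : X →ₗ.[ℝ] F} {H : X →L[ℝ] Y} {y : Y} {φ : L.domain}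
    (hφ : ∀ x : L.domain, inner ℝ (L φ) (L x) = inner ℝ (y - H (φ : X)) (H (x : X)))
    (hy : (aPosterioriSet L H (jointBall F Y) y).Nonempty) :
    inner ℝ y (y - H (φ : X)) ≤ 1 := by
  obtain ⟨ψ, hψ⟩ := hy
  obtain ⟨x, -, hx⟩ := (mem_aPosterioriSet_iff hφ ψ).1 hψ
  nlinarith [sq_nonneg ‖L x‖, sq_nonneg ‖H (x : X)‖]

theorem symmetric_aPosterioriSet {L : X →ₗ.[ℝ] F} {H : X →L[ℝ] Y} {y : Y} {φ : L.domain}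
    (hφ : ∀ x : L.domain, inner ℝ (L φ) (L x) = inner ℝ (y - H (φ : X)) (H (x : X))) :
    ∀ ψ ∈ aPosterioriSet L H (jointBall F Y) y,
      (φ : X) + (φ - ψ) ∈ aPosterioriSet L H (jointBall F Y) y := by
  intro ψ hψ
  obtain ⟨x, rfl, hx⟩ := (mem_aPosterioriSet_iff hφ ψ).1 hψ
  refine (mem_aPosterioriSet_iff hφ _).2 ⟨-x, by simp, ?_⟩
  simpa [L.map_neg] using hx

/-- Cauchy-Schwarz in the product, in a two-term form. -/
theorem inner_add_inner_sq_le (a b : F) (c d : Y) :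
    (inner ℝ a b + inner ℝ c d) ^ 2 ≤ (‖a‖ ^ 2 + ‖c‖ ^ 2) * (‖b‖ ^ 2 + ‖d‖ ^ 2) := by
  have h := abs_real_inner_le_norm (WithLp.toLp 2 (a, c)) (WithLp.toLp 2 (b, d))
  have h' := pow_le_pow_left₀ (abs_nonneg _) h 2
  rw [sq_abs, mul_pow, WithLp.prod_norm_sq_eq_of_L2, WithLp.prod_norm_sq_eq_of_L2] at h'
  exact h'

theorem worstError_eq_of_representer {L : X →ₗ.[ℝ] F} {H : X →L[ℝ] Y} {y : Y} {φ : L.domain}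
    (hφ : ∀ x : L.domain, inner ℝ (L φ) (L x) = inner ℝ (y - H (φ : X)) (H (x : X)))
    (hβ : inner ℝ y (y - H (φ : X)) ≤ 1) {l : X} {x₀ : L.domain}
    (hx₀ : ∀ x : L.domain,
      inner ℝ l (x : X) = inner ℝ (L x₀) (L x) + inner ℝ (H (x₀ : X)) (H (x : X))) :
    worstError (aPosterioriSet L H (jointBall F Y) y) l φ =
      ENNReal.ofReal (√(1 - inner ℝ y (y - H (φ : X)))) *
        ENNReal.ofReal (√(‖L x₀‖ ^ 2 + ‖H (x₀ : X)‖ ^ 2)) := by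
  have hβ0 : 0 ≤ 1 - inner ℝ y (y - H (φ : X)) := sub_nonneg.2 hβ
  set β2 := 1 - inner ℝ y (y - H (φ : X)) with hβ2
  set p2 := ‖L x₀‖ ^ 2 + ‖H (x₀ : X)‖ ^ 2 with hp2
  have hp0 : 0 ≤ p2 := by positivity
  rw [← ENNReal.ofReal_mul (Real.sqrt_nonneg _), ← Real.sqrt_mul hβ0]
  refine le_antisymm (iSup₂_le fun ψ hψ => ?_) ?_
  · obtain ⟨x, rfl, hx⟩ := (mem_aPosterioriSet_iff hφ ψ).1 hψ
    apply ENNReal.ofReal_le_ofReal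
    rw [inner_add_right, sub_add_cancel_left, abs_neg, hx₀]
    refine Real.le_sqrt_of_sq_le ?_
    rw [sq_abs]
    refine (inner_add_inner_sq_le _ _ _ _).trans ?_
    rw [mul_comm]
    exact mul_le_mul_of_nonneg_right hx hp0
  · have hmem : (φ : X) + ((√β2 / √p2) • x₀ : L.domain) ∈
        aPosterioriSet L H (jointBall F Y) y := by
      refine (mem_aPosterioriSet_iff hφ _).2 ⟨_, rfl, ?_⟩
      rw [L.map_smul, Submodule.coe_smul, map_smul, norm_smul, norm_smul, mul_pow, mul_pow,
        ← mul_add, ← hp2, Real.norm_eq_abs, sq_abs, div_pow, Real.sq_sqrt hβ0, Real.sq_sqrt hp0]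
      rcases hp0.eq_or_lt with h | h
      · rwa [← h, mul_zero]
      · exact (div_mul_cancel₀ β2 h.ne').le
    refine le_iSup₂_of_le _ hmem (ENNReal.ofReal_le_ofReal ?_)
    rw [inner_add_right, sub_add_cancel_left, abs_neg, Submodule.coe_smul, inner_smul_right,
      hx₀, real_inner_self_eq_norm_sq, real_inner_self_eq_norm_sq, ← hp2, Real.sqrt_mul hβ0,
      div_mul_eq_mul_div, mul_div_assoc, Real.div_sqrt]
    exact le_abs_self _

end MinimaxEstimation

/-! ### Noise laws and the a priori error. -/

namespace MinimaxEstimation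

section Noise

variable {Y : Type*} [NormedAddCommGroup Y] [MeasurableSpace Y]

/-- The law of a random vector equal to `v` or `-v` with probability `1/2` each. -/
noncomputable def twoPointLaw (v : Y) : Measure Y :=
  (2⁻¹ : ℝ≥0∞) • (Measure.dirac v + Measure.dirac (-v))

instance isProbabilityMeasure_twoPointLaw (v : Y) : IsProbabilityMeasure (twoPointLaw v) := by
  constructor
  simp [twoPointLaw, ENNReal.inv_two_add_inv_two]

theorem integral_twoPointLaw [BorelSpace Y] {E : Type*} [NormedAddCommGroup E] [NormedSpace ℝ E]
    [CompleteSpace E] (v : Y) (f : Y → E) :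
    ∫ η, f η ∂twoPointLaw v = (2⁻¹ : ℝ) • (f v + f (-v)) := by
  have hi (w : Y) : Integrable f (Measure.dirac w) := integrable_dirac (by simp)
  rw [twoPointLaw, integral_smul_measure, integral_add_measure (hi v) (hi (-v)),
    integral_dirac, integral_dirac]
  simp

theorem lintegral_twoPointLaw [BorelSpace Y] (v : Y) (f : Y → ℝ≥0∞) :
    ∫⁻ η, f η ∂twoPointLaw v = 2⁻¹ * (f v + f (-v)) := by
  rw [twoPointLaw, lintegral_smul_measure, lintegral_add_measure, lintegral_dirac,
    lintegral_dirac, smul_eq_mul]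

variable [InnerProductSpace ℝ Y] [CompleteSpace Y]

theorem twoPointLaw_mem_noiseLaws [BorelSpace Y] {v : Y} (hv : ‖v‖ ≤ 1) : twoPointLaw v ∈ noiseLaws Y := by
  refine ⟨inferInstance, ?_, ?_, ?_⟩
  · have hm (w : Y) : AEStronglyMeasurable (fun η : Y => η) (Measure.dirac w) :=
      aestronglyMeasurable_dirac
    refine MemLp.of_bound (C := ‖v‖) ?_ ?_
    · exact (aestronglyMeasurable_add_measure_iff.2 ⟨hm v, hm (-v)⟩).smul_measure _
    · refine Measure.ae_smul_measure (ae_add_measure_iff.2 ⟨?_, ?_⟩) _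
      · simp [ae_dirac_eq]
      · simp [ae_dirac_eq]
  · rw [integral_twoPointLaw]
    simp
  · rw [integral_twoPointLaw]
    simp only [inner_neg_neg, real_inner_self_eq_norm_sq, smul_eq_mul]
    nlinarith [norm_nonneg v]

/-- The mean-squared error for a noise of zero mean and unit energy. -/
theorem lintegral_sq_le {μ : Measure Y} (hμ : μ ∈ noiseLaws Y) (a : ℝ) (u : Y) :
    ∫⁻ η, ENNReal.ofReal ((a - inner ℝ u η) ^ 2) ∂μ ≤ ENNReal.ofReal (a ^ 2 + ‖u‖ ^ 2) := by
  obtain ⟨hp, hL, hmean, hvar⟩ := hμ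
  have hint : Integrable (fun η : Y => η) μ := hL.integrable (by norm_num)
  have hu : MemLp (fun η : Y => inner ℝ u η) 2 μ := hL.const_inner u
  have hu1 : Integrable (fun η : Y => inner ℝ u η) μ := hu.integrable (by norm_num)
  have hu2 : Integrable (fun η : Y => (inner ℝ u η) ^ 2) μ := hu.integrable_sq
  have hn : Integrable (fun η : Y => inner ℝ η η) μ := by
    simpa only [real_inner_self_eq_norm_sq] using hL.norm.integrable_sq
  have hmean' : ∫ η, inner ℝ u η ∂μ = 0 := by
    rw [integral_inner hint, hmean, inner_zero_right]
  have hvar' : ∫ η, (inner ℝ u η) ^ 2 ∂μ ≤ ‖u‖ ^ 2 := by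
    calc ∫ η, (inner ℝ u η) ^ 2 ∂μ ≤ ∫ η, ‖u‖ ^ 2 * inner ℝ η η ∂μ := by
          refine integral_mono hu2 (hn.const_mul _) fun η => ?_
          have := pow_le_pow_left₀ (abs_nonneg _) (abs_real_inner_le_norm u η) 2
          rwa [sq_abs, mul_pow, ← real_inner_self_eq_norm_sq η] at this
      _ = ‖u‖ ^ 2 * ∫ η, inner ℝ η η ∂μ := integral_const_mul _ _
      _ ≤ ‖u‖ ^ 2 := mul_le_of_le_one_right (sq_nonneg _) hvar
  have e : (fun η : Y => (a - inner ℝ u η) ^ 2) =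
      fun η => a ^ 2 - 2 * a * inner ℝ u η + (inner ℝ u η) ^ 2 := by
    funext η
    ring
  have hi1 : Integrable (fun η : Y => a ^ 2 - 2 * a * inner ℝ u η) μ :=
    (integrable_const _).sub (hu1.const_mul _)
  rw [← ofReal_integral_eq_lintegral_ofReal (by rw [e]; exact hi1.add hu2)
    (Filter.Eventually.of_forall fun η => sq_nonneg _), e]
  apply ENNReal.ofReal_le_ofReal
  rw [integral_add hi1 hu2, integral_sub (integrable_const _) (hu1.const_mul _),
    integral_const_mul, hmean', integral_const]
  simpa using hvar'

end Noise

variable {X F Y : Type*}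
  [NormedAddCommGroup X] [InnerProductSpace ℝ X]
  [NormedAddCommGroup F] [InnerProductSpace ℝ F]
  [NormedAddCommGroup Y] [InnerProductSpace ℝ Y] [CompleteSpace Y]
  [MeasurableSpace Y]

/-- With this estimate the error is `(L x₀, L φ) - (H x₀, η)`; the zero-mean noise removes the cross
term and each square is bounded by Cauchy-Schwarz. -/
theorem aPrioriRisk_le {L : X →ₗ.[ℝ] F} {H : X →L[ℝ] Y} {l : X} {x₀ : L.domain}
    (hx₀ : ∀ x : L.domain,
      inner ℝ l (x : X) = inner ℝ (L x₀) (L x) + inner ℝ (H (x₀ : X)) (H (x : X))) :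
    aPrioriRisk L H {f : F | inner ℝ f f ≤ 1} (noiseLaws Y) l (H (x₀ : X)) 0 ≤
      ENNReal.ofReal (‖L x₀‖ ^ 2 + ‖H (x₀ : X)‖ ^ 2) := by
  refine iSup₂_le fun φ hφ => iSup₂_le fun μ hμ => ?_
  have e (η : Y) : inner ℝ l (φ : X) - (inner ℝ (H (x₀ : X)) (H (φ : X) + η) + 0) =
      inner ℝ (L x₀) (L φ) - inner ℝ (H (x₀ : X)) η := by
    rw [hx₀, inner_add_right]
    ring
  simp only [e]
  refine (lintegral_sq_le hμ _ _).trans (ENNReal.ofReal_le_ofReal ?_)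
  have hφ' : ‖L φ‖ ^ 2 ≤ 1 := by
    rw [← real_inner_self_eq_norm_sq]
    exact hφ
  have := pow_le_pow_left₀ (abs_nonneg _) (abs_real_inner_le_norm (L x₀) (L φ)) 2
  rw [sq_abs, mul_pow] at this
  nlinarith [sq_nonneg ‖L x₀‖]

variable [BorelSpace Y]

/-- Testing the risk with one state, up to sign, and a two-point noise. -/
theorem le_aPrioriRisk {L : X →ₗ.[ℝ] F} {H : X →L[ℝ] Y} (l : X) (u : Y) (c : ℝ)
    {φ : L.domain} (hφ : ‖L φ‖ ≤ 1) :
    ENNReal.ofReal ((inner ℝ l (φ : X) - inner ℝ u (H (φ : X))) ^ 2 + ‖u‖ ^ 2) ≤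
      aPrioriRisk L H {f : F | inner ℝ f f ≤ 1} (noiseLaws Y) l u c := by
  -- Choosing the sign of `φ` makes the shift by `c` only increase the squared bias.
  wlog hc : c * (inner ℝ l (φ : X) - inner ℝ u (H (φ : X))) ≤ 0 generalizing φ
  · have := this (φ := -φ) (by rwa [L.map_neg, norm_neg]) (by
      rw [Submodule.coe_neg, map_neg, inner_neg_right, inner_neg_right]
      linarith)
    rwa [Submodule.coe_neg, map_neg, inner_neg_right, inner_neg_right, neg_sub_neg,
      sub_sq_comm] at this
  have hmem : inner ℝ (L φ) (L φ) ≤ (1 : ℝ) := by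
    rw [real_inner_self_eq_norm_sq]
    exact pow_le_one₀ (norm_nonneg _) hφ
  -- Noise along `u` at full energy; for `u = 0` the convention `0⁻¹ = 0` gives zero noise.
  have hv : ‖‖u‖⁻¹ • u‖ ≤ 1 := by
    rw [norm_smul, norm_inv, norm_norm]
    exact inv_mul_le_one
  have huv : inner ℝ u (‖u‖⁻¹ • u) = ‖u‖ := by
    rw [inner_smul_right, real_inner_self_eq_norm_sq, sq, ← mul_assoc]
    rcases eq_or_ne ‖u‖ 0 with h | h
    · simp [h]
    · rw [inv_mul_cancel₀ h, one_mul]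
  refine le_trans ?_ (le_iSup₂_of_le φ hmem
    (le_iSup₂_of_le _ (twoPointLaw_mem_noiseLaws hv) le_rfl))
  rw [lintegral_twoPointLaw, ← ENNReal.ofReal_add (sq_nonneg _) (sq_nonneg _),
    ← ENNReal.ofReal_ofNat 2, ← ENNReal.ofReal_inv_of_pos two_pos,
    ← ENNReal.ofReal_mul (by positivity)]
  apply ENNReal.ofReal_le_ofReal
  rw [inner_add_right, inner_add_right, inner_neg_right, huv]
  nlinarith [sq_nonneg c]

/-- Scalar core of the lower bound, with `a = ‖L x₀‖`, `b = ‖H x₀‖`, `w = ‖u‖`, `k = (u, H x₀)`, `R`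
the risk and `t x₀` the test states. -/
theorem energy_le_of_forall_test {a b w k R : ℝ} (ha : 0 ≤ a) (hb : 0 ≤ b)
    (hw : 0 ≤ w) (hk : k ≤ b * w)
    (h : ∀ t : ℝ, |t| * a ≤ 1 → t ^ 2 * (a ^ 2 + b ^ 2 - k) ^ 2 + w ^ 2 ≤ R) :
    a ^ 2 + b ^ 2 ≤ R := by
  rcases ha.eq_or_lt with rfl | ha
  · by_contra hR
    rw [not_le] at hR
    have hwb : w < b := by
      have := h 0 (by simp)
      nlinarith
    have hpos : 0 < b ^ 2 - k := by nlinarith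
    -- For `a = 0` every `t` is admissible; this one makes the bias term equal `b ^ 2`,
    -- contradicting `R < b ^ 2`.
    have := h (b / (b ^ 2 - k)) (by simp)
    have e : (b / (b ^ 2 - k)) ^ 2 * (0 ^ 2 + b ^ 2 - k) ^ 2 = b ^ 2 := by
      field_simp
      ring
    rw [e] at this
    nlinarith [sq_nonneg w]
  -- The largest admissible `t`. Then `a² + b² ≤ a x + b w`, and completing squares gives `a² + b² ≤
  -- x² + w²`.
  · have h1 := h (1 / a) (by rw [abs_of_pos (by positivity)]; field_simp; exact le_rfl)
    set x := (a ^ 2 + b ^ 2 - k) / a with hx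
    have hx1 : a * x = a ^ 2 + b ^ 2 - k := by
      rw [hx]
      field_simp
    have hx2 : (1 / a) ^ 2 * (a ^ 2 + b ^ 2 - k) ^ 2 = x ^ 2 := by
      rw [hx]
      field_simp
    rw [hx2] at h1
    have h2 : a ^ 2 + b ^ 2 ≤ a * x + b * w := by linarith
    nlinarith [sq_nonneg (a - x), sq_nonneg (b - w)]

theorem le_aPrioriRisk_of_representer {L : X →ₗ.[ℝ] F} {H : X →L[ℝ] Y} {l : X} {x₀ : L.domain}
    (hx₀ : ∀ x : L.domain,
      inner ℝ l (x : X) = inner ℝ (L x₀) (L x) + inner ℝ (H (x₀ : X)) (H (x : X)))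
    (u : Y) (c : ℝ) :
    ENNReal.ofReal (‖L x₀‖ ^ 2 + ‖H (x₀ : X)‖ ^ 2) ≤
      aPrioriRisk L H {f : F | inner ℝ f f ≤ 1} (noiseLaws Y) l u c := by
  rcases eq_or_ne (aPrioriRisk L H {f : F | inner ℝ f f ≤ 1} (noiseLaws Y) l u c) ⊤ with hT | hT
  · rw [hT]
    exact le_top
  rw [ENNReal.ofReal_le_iff_le_toReal hT]
  refine energy_le_of_forall_test (norm_nonneg _) (norm_nonneg _) (norm_nonneg u)
    (k := inner ℝ u (H (x₀ : X))) ?_ fun t ht => ?_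
  · rw [mul_comm]
    exact real_inner_le_norm _ _
  · rw [← ENNReal.ofReal_le_iff_le_toReal hT]
    have := le_aPrioriRisk (H := H) l u c (φ := t • x₀) (by rwa [L.map_smul, norm_smul])
    rwa [Submodule.coe_smul, map_smul, inner_smul_right, inner_smul_right, hx₀,
      real_inner_self_eq_norm_sq, real_inner_self_eq_norm_sq, ← mul_sub, mul_pow] at this

theorem aPrioriError_eq_of_representer {L : X →ₗ.[ℝ] F} {H : X →L[ℝ] Y} {l : X} {x₀ : L.domain}
    (hx₀ : ∀ x : L.domain,
      inner ℝ l (x : X) = inner ℝ (L x₀) (L x) + inner ℝ (H (x₀ : X)) (H (x : X))) :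
    aPrioriError L H {f : F | inner ℝ f f ≤ 1} (noiseLaws Y) l =
      ENNReal.ofReal (√(‖L x₀‖ ^ 2 + ‖H (x₀ : X)‖ ^ 2)) := by
  have h : ⨅ (u : Y) (c : ℝ), aPrioriRisk L H {f : F | inner ℝ f f ≤ 1} (noiseLaws Y) l u c =
      ENNReal.ofReal (‖L x₀‖ ^ 2 + ‖H (x₀ : X)‖ ^ 2) :=
    le_antisymm (iInf₂_le_of_le _ _ (aPrioriRisk_le hx₀))
      (le_iInf₂ (le_aPrioriRisk_of_representer hx₀))
  rw [aPrioriError, h, ENNReal.ofReal_rpow_of_nonneg (by positivity) (by norm_num),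
    Real.sqrt_eq_rpow]

end MinimaxEstimation

/-! ### Duality between `R(L*) + R(H*)` and `N(L) ∩ N(H)`. -/

namespace MinimaxEstimation

variable {X F Y : Type*}
  [NormedAddCommGroup X] [InnerProductSpace ℝ X] [CompleteSpace X]
  [NormedAddCommGroup F] [InnerProductSpace ℝ F] [CompleteSpace F]
  [NormedAddCommGroup Y] [InnerProductSpace ℝ Y] [CompleteSpace Y]

theorem exists_representer_of_mem_adjointRangeSum {L : X →ₗ.[ℝ] F} (hL : L.IsClosed)
    (hd : Dense (L.domain : Set X)) (H : X →L[ℝ] Y)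
    (hR : IsClosed (LinearMap.range (stackedMap L H).toFun : Set (WithLp 2 (F × Y)))) {l : X}
    (hl : l ∈ adjointRangeSum L H) :
    ∃ x₀ : L.domain, ∀ x : L.domain,
      inner ℝ l (x : X) = inner ℝ (L x₀) (L x) + inner ℝ (H (x₀ : X)) (H (x : X)) := by
  obtain ⟨z, u, h⟩ := (mem_adjointRangeSum_iff hd H l).1 hl
  exact exists_representer hL H hR fun x h1 h2 => by rw [h, h1, h2]; simp

/-- A vector orthogonal to `R(L*) + R(H*)` lies in `N(L) ∩ N(H)`. -/
theorem mem_ker_of_forall_inner_eq_zero {L : X →ₗ.[ℝ] F} (hL : L.IsClosed)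
    (hd : Dense (L.domain : Set X)) (H : X →L[ℝ] Y)
    (hR : IsClosed (LinearMap.range (stackedMap L H).toFun : Set (WithLp 2 (F × Y)))) {w : X}
    (hw : ∀ l ∈ adjointRangeSum L H, inner ℝ l w = 0) :
    ∃ x : L.domain, (x : X) = w ∧ L x = 0 ∧ H w = 0 := by
  let N : Submodule ℝ X := (LinearMap.ker (stackedMap L H).toFun).map L.domain.subtype
  have hmem (x : X) : x ∈ N ↔ (x, (0 : WithLp 2 (F × Y))) ∈ (stackedMap L H).graph := by
    rw [LinearPMap.mem_graph_iff]
    constructor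
    · rintro ⟨k, hk, rfl⟩
      exact ⟨k, rfl, hk⟩
    · rintro ⟨k, hk, hk0⟩
      exact ⟨k, hk0, hk⟩
  have hNc : IsClosed (N : Set X) := by
    have : (N : Set X) = (fun x : X => (x, (0 : WithLp 2 (F × Y)))) ⁻¹'
        (stackedMap L H).graph := Set.ext hmem
    rw [this]
    exact IsClosed.preimage (by fun_prop) (isClosed_stackedMap hL H)
  have : CompleteSpace N := hNc.completeSpace_coe
  -- Every vector of `Nᗮ` has a representer and so lies in `R(L*) + R(H*)`; hence `w ∈ Nᗮᗮ = N`.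
  have hwN : w ∈ N := by
    rw [← Submodule.orthogonal_orthogonal N, Submodule.mem_orthogonal]
    intro l hl
    apply hw
    obtain ⟨x₀, hx₀⟩ := exists_representer hL H hR (l := l) fun x h1 h2 => by
      rw [real_inner_comm]
      refine (Submodule.mem_orthogonal N l).1 hl x ⟨x, ?_, rfl⟩
      change stackedMap L H x = 0
      rw [stackedMap_apply, h1, h2]
      rfl
    exact (mem_adjointRangeSum_iff hd H l).2 ⟨_, _, hx₀⟩
  obtain ⟨x, hx, rfl⟩ := hwN
  have hx' : (L x, H (x : X)) = 0 := congrArg WithLp.ofLp hx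
  exact ⟨x, rfl, congrArg Prod.fst hx', congrArg Prod.snd hx'⟩

end MinimaxEstimation

/-! ### The main theorem. -/

open MinimaxEstimation in
theorem mainTheorem3
    {X F Y : Type*}
    [NormedAddCommGroup X] [InnerProductSpace ℝ X] [CompleteSpace X]
    [NormedAddCommGroup F] [InnerProductSpace ℝ F] [CompleteSpace F]
    [NormedAddCommGroup Y] [InnerProductSpace ℝ Y] [CompleteSpace Y]
    [MeasurableSpace Y] [BorelSpace Y]
    (L : X →ₗ.[ℝ] F) (hLclosed : L.IsClosed) (hLdense : Dense (L.domain : Set X))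
    (H : X →L[ℝ] Y)
    (hcond :
      (IsClosed {f : F | ∃ x : L.domain, L x = f} ∧
        IsClosed {v : Y | ∃ x : L.domain, L x = 0 ∧ H (x : X) = v}) ∨
      IsClosed {p : F × Y | ∃ x : L.domain, (L x, H (x : X)) = p})
    (y : Y)
    (hy : (MinimaxEstimation.aPosterioriSet L H (MinimaxEstimation.jointBall F Y) y).Nonempty) :
    -- the system is solvable
    (∃ (φ : X) (q : F), MinimaxEstimation.SolvesSystem L H y φ q) ∧
    -- its solutions are the vectors that are minimax in every direction of `R(L*) + R(H*)`
    (∀ φ : X,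
      (∃ q : F, MinimaxEstimation.SolvesSystem L H y φ q) ↔
        ∀ l ∈ MinimaxEstimation.adjointRangeSum L H,
          MinimaxEstimation.IsMinimaxEstimate
            (MinimaxEstimation.aPosterioriSet L H (MinimaxEstimation.jointBall F Y) y) l φ) ∧
    ∀ (φ : X) (q : F), MinimaxEstimation.SolvesSystem L H y φ q →
      φ ∈ MinimaxEstimation.aPosterioriSet L H (MinimaxEstimation.jointBall F Y) y ∧
      inner ℝ y (y - H φ) ≤ 1 ∧
      ∀ l : X,
        -- a solution is a minimax estimate (with finite error) in exactly these directions
        ((MinimaxEstimation.IsMinimaxEstimate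
              (MinimaxEstimation.aPosterioriSet L H (MinimaxEstimation.jointBall F Y) y) l φ ∧
            MinimaxEstimation.aPosterioriError
              (MinimaxEstimation.aPosterioriSet L H (MinimaxEstimation.jointBall F Y) y) l < ⊤) ↔
          l ∈ MinimaxEstimation.adjointRangeSum L H) ∧
        (l ∈ MinimaxEstimation.adjointRangeSum L H →
          -- in such a direction the minimax estimate of `(l, ·)` is unique and equals `(l, φ)`
          (∀ φ' : X,
            MinimaxEstimation.IsMinimaxEstimate
                (MinimaxEstimation.aPosterioriSet L H (MinimaxEstimation.jointBall F Y) y) l φ' ↔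
              inner ℝ l φ' = inner ℝ l φ) ∧
          -- the error formula, between finite quantities
          MinimaxEstimation.aPrioriError L H {f : F | inner ℝ f f ≤ 1}
              (MinimaxEstimation.noiseLaws Y) l < ⊤ ∧
          MinimaxEstimation.aPosterioriError
              (MinimaxEstimation.aPosterioriSet L H (MinimaxEstimation.jointBall F Y) y) l =
            ENNReal.ofReal (√(1 - inner ℝ y (y - H φ))) *
              MinimaxEstimation.aPrioriError L H {f : F | inner ℝ f f ≤ 1}
                (MinimaxEstimation.noiseLaws Y) l) := by
  have hR := isClosed_range_stackedMap hLclosed H hcond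
  set S := aPosterioriSet L H (jointBall F Y) y with hS
  have hsol (φ : L.domain)
      (hφ : ∀ x : L.domain, inner ℝ (L φ) (L x) = inner ℝ (y - H (φ : X)) (H (x : X))) :
      inner ℝ y (y - H (φ : X)) ≤ 1 ∧ (φ : X) ∈ S ∧
      (∀ l ∈ adjointRangeSum L H,
        aPrioriError L H {f : F | inner ℝ f f ≤ 1} (noiseLaws Y) l < ⊤ ∧
        worstError S l φ = ENNReal.ofReal (√(1 - inner ℝ y (y - H (φ : X)))) *
          aPrioriError L H {f : F | inner ℝ f f ≤ 1} (noiseLaws Y) l) := by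
    have hβ := inner_residual_le_one hφ hy
    refine ⟨hβ, (mem_aPosterioriSet_iff hφ _).2 ⟨0, by simp, by simpa [L.map_zero] using hβ⟩,
      fun l hl => ?_⟩
    obtain ⟨x₀, hx₀⟩ := exists_representer_of_mem_adjointRangeSum hLclosed hLdense H hR hl
    rw [aPrioriError_eq_of_representer hx₀]
    exact ⟨ENNReal.ofReal_lt_top, worstError_eq_of_representer hφ hβ hx₀⟩
  have hfin (φ : L.domain)
      (hφ : ∀ x : L.domain, inner ℝ (L φ) (L x) = inner ℝ (y - H (φ : X)) (H (x : X))) (l : X)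
      (hl : l ∈ adjointRangeSum L H) : worstError S l φ ≠ ⊤ := by
    obtain ⟨-, -, h⟩ := hsol φ hφ
    rw [(h l hl).2]
    exact ENNReal.mul_ne_top ENNReal.ofReal_ne_top (h l hl).1.ne
  obtain ⟨φ₀, hφ₀⟩ := exists_weak_solution (L := L) H hR y
  refine ⟨⟨φ₀, (exists_solvesSystem_iff hLdense H y φ₀).2 ⟨φ₀.2, hφ₀⟩⟩, fun φ => ?_, ?_⟩
  · rw [exists_solvesSystem_iff hLdense]
    constructor
    · rintro ⟨hφd, hφ⟩ l -
      exact aPosterioriError_eq (φ := φ) (hsol ⟨φ, hφd⟩ hφ).2.1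
        (symmetric_aPosterioriSet (φ := ⟨φ, hφd⟩) hφ) l
    · intro h
      obtain ⟨x, hx, hLx, hHx⟩ := mem_ker_of_forall_inner_eq_zero hLclosed hLdense H hR
        (w := φ - φ₀) fun l hl => by
          rw [inner_sub_right, sub_eq_zero]
          exact (isMinimaxEstimate_iff (hsol φ₀ hφ₀).2.1 (symmetric_aPosterioriSet hφ₀)
            (hfin φ₀ hφ₀ l hl) φ).1 (h l hl)
      obtain rfl : φ = ((x + φ₀ : L.domain) : X) := by simp [hx]
      refine ⟨(x + φ₀).2, fun z => ?_⟩
      have e : H ((x + φ₀ : L.domain) : X) = H (φ₀ : X) := by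
        rw [← sub_eq_zero, ← map_sub]
        exact hHx
      rw [e, ← hφ₀ z]
      congr 1
      rw [Subtype.coe_eta, L.map_add, hLx, zero_add]
  · intro φ q hsys
    obtain ⟨hφd, hφ⟩ := (exists_solvesSystem_iff hLdense H y φ).1 ⟨q, hsys⟩
    obtain ⟨hβ, hmem, herr⟩ := hsol ⟨φ, hφd⟩ hφ
    have hsymm := symmetric_aPosterioriSet (φ := ⟨φ, hφd⟩) hφ
    have hmin (l : X) := aPosterioriError_eq (φ := φ) hmem hsymm l
    refine ⟨hmem, hβ, fun l => ⟨⟨fun ⟨_, hlt⟩ => ?_, fun hl => ⟨hmin l, ?_⟩⟩, fun hl => ⟨?_, ?_, ?_⟩⟩⟩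
    · rw [hmin] at hlt
      -- The set is invariant along `N(L) ∩ N(H)`, so finite error makes `l` orthogonal to it.
      obtain ⟨x₀, hx₀⟩ := exists_representer hLclosed H hR (l := l) fun x h1 h2 =>
        inner_eq_zero_of_worstError_ne_top hlt.ne fun t =>
          (mem_aPosterioriSet_iff (φ := ⟨φ, hφd⟩) hφ _).2 ⟨t • x, rfl, by
            simpa [L.map_smul, h1, h2] using hβ⟩
      exact (mem_adjointRangeSum_iff hLdense H l).2 ⟨_, _, hx₀⟩
    · rw [hmin]
      exact (hfin ⟨φ, hφd⟩ hφ l hl).lt_top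
    · exact isMinimaxEstimate_iff hmem hsymm (hfin ⟨φ, hφd⟩ hφ l hl)
    · exact (herr l hl).1
    · rw [hmin]
      exact (herr l hl).2
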